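/- There is an absolute constant $K>0$ such that the following holds for every $0<\epsilon<1$ and every integer $s\ge 1$ with $2^{-s}\le\epsilon\le 2^{1-s}$; put $m=2^s$. For a prime $p$ and primes $5\le t_1<t_2<\dots<t_m$ put $q=p^{t_1t_2\cdots t_m}$ and $n=m\,p^{t_1-2}$. For $1\le i\le m$ let $\beta_i$ be an element of $\mathbb F_q$ that generates the subfield $\mathbb F_{p^{t_i}}$ over $\mathbb F_p$ (such elements exist), let $$G_i=\beta_i+\mathrm{span}_{\mathbb F_p}\{\beta_i^2,\dots,\beta_i^{t_1-1}\}\subseteq \mathbb F_{p^{t_i}},\qquad S=G_1\cup\dots\cup G_m .$$ (i) Then $|S|=n$ and, for every enumeration $\alpha_1,\dots,\alpha_n$ of $S$ without repetition, the Reed--Solomon code $\{(f(\alpha_1),\dots,f(\alpha_n)) : f\in\mathbb F_q[x],\ \deg f<2\}$ has dimension $2$, and its minimum insdel distance $d$ (the least number of insertions and deletions that transform a codeword into a different one) satisfies $$d\ \ge\ 2(1-\epsilon)n-\frac{K}{\epsilon^2}.$$ (ii) For a fixed prime $p$, and $t_1,\dots,t_m$ consecutive primes with $t_1\to\infty$,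 the length satisfies $\log n=\Theta\big((\log q)^{1/2^s}\big)$, that is, $n=\exp\big(\Theta((\log q)^{2^{-s}})\big)$; in particular the exponent is $\epsilon$ if $\epsilon=2^{-s}$. (iii) If $2^{-s}<\epsilon$, then for consecutive primes $t_1,\dots,t_m$ with $t_1\to\infty$ one can choose the prime $p$ as a function of $t_1$ in such a way that $\log n\sim(\log q)^{\epsilon}$, that is, $n=\exp\big((1+o(1))(\log q)^{\epsilon}\big)$ along a sequence $q\to\infty$. -/

import Mathlib

open scoped IntermediateField Asymptotics

/-- One elementary edit of a word: the insertion or the deletion of one letter. -/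
inductive InsdelStep {A : Type*} : List A → List A → Prop
  | insertion (u v : List A) (a : A) : InsdelStep (u ++ v) (u ++ a :: v)
  | deletion (u v : List A) (a : A) : InsdelStep (u ++ a :: v) (u ++ v)

/-- `InsdelSteps k u v`: the word `u` can be transformed into `v` by exactly `k` insertions
and deletions. -/
inductive InsdelSteps {A : Type*} : ℕ → List A → List A → Prop
  | refl (u : List A) : InsdelSteps 0 u u
  | tail {k : ℕ} {u v w : List A} :
      InsdelSteps k u v → InsdelStep v w → InsdelSteps (k + 1) u w

/-- The insdel distance of two words: the minimum number of insertions and deletions which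
transform one into the other. (The set is never empty: delete everything, insert everything.) -/
noncomputable def insdelDist {A : Type*} (u v : List A) : ℕ :=
  sInf {k : ℕ | InsdelSteps k u v}

/-- The minimum insdel distance of a code of length `n`. -/
noncomputable def minInsdelDist {A : Type*} {n : ℕ} (C : Set (Fin n → A)) : ℕ :=
  sInf {d : ℕ | ∃ c₁ ∈ C, ∃ c₂ ∈ C, c₁ ≠ c₂ ∧ d = insdelDist (List.ofFn c₁) (List.ofFn c₂)}

/-- The Reed-Solomon code of all words `(f (α 0), …, f (α (n - 1)))`, where `f` runs over the
polynomials of degree less than `k`. -/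
noncomputable def reedSolomon {F : Type*} [Field F] {n : ℕ} (k : ℕ) (α : Fin n → F) :
    Submodule F (Fin n → F) :=
  (Polynomial.degreeLT F k).map (LinearMap.pi fun i => Polynomial.leval (α i))

/-- The affine block `β + span_{𝔽_p} {β ^ 2, …, β ^ (r - 1)}`. -/
def affineBlock (p r : ℕ) {F : Type*} [Field F] [Algebra (ZMod p) F] (β : F) : Set F :=
  {x : F | ∃ y ∈ Submodule.span (ZMod p) ((fun j : ℕ => β ^ j) '' Set.Icc 2 (r - 1)), x = β + y}

/-- The evaluation set: the union of the `m` affine blocks `β i + span {β i ^ 2, …, β i ^ (r - 1)}`. -/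
def evalSet (p r : ℕ) {F : Type*} [Field F] [Algebra (ZMod p) F] {m : ℕ} (β : Fin m → F) :
    Set F :=
  ⋃ i : Fin m, affineBlock p r (β i)

/-- `β i` generates the subfield with `p ^ (t i)` elements, for each `i`. -/
def GeneratesSubfields (p : ℕ) [Fact p.Prime] (t : ℕ → ℕ) {F : Type*} [Field F]
    [Algebra (ZMod p) F] {m : ℕ} (β : Fin m → F) : Prop :=
  ∀ i : Fin m, Nat.card ((ZMod p)⟮β i⟯) = p ^ t i

/-- The field size `q = p ^ (t 0 * ⋯ * t (m - 1))`. -/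
def fieldSize (p m : ℕ) (t : ℕ → ℕ) : ℕ := p ^ ∏ i ∈ Finset.range m, t i

/-- The code length `n = m * p ^ (t 0 - 2)`; in all uses `5 ≤ t 0`. -/
def codeLength (p m : ℕ) (t : ℕ → ℕ) : ℕ := m * p ^ (t 0 - 2)

/-- The sequence of consecutive primes which starts at the `a`-th prime
(counted from zero, so `a = 2` starts at `5`). -/
noncomputable def consecutivePrimes (a : ℕ) : ℕ → ℕ := fun i => Nat.nth Nat.Prime (a + i)

/-!
Two words of length `n` without a common subsequence longer than `ℓ` have insdel distance at least
`2 * (n - ℓ)`, because an insertion preserves a common subsequence and a deletion costs it at most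
one letter. For two codewords `a * x + b` and `a' * x + b'` at least one of which is injective, a
common subsequence has no repeated letter, so its length is at most the number of common letters,
whatever the order of the evaluation points. If both are injective, this is the number of points
`x` of the evaluation set `S` for which `A * x + B` lies in `S`, for the nontrivial affine map with
`A = a / a'` and `B = (b - b') / a'` (`two_mul_le_minInsdelDist`).

The affine map therefore must not keep more than `p ^ (t 0 - 2) + m ^ 2` points of the `m` blocks
`β i + V i` in `S` (`IsBlockFamily.ncard_affine_le`). For each pair `(i, j)`, count the points of
block `i` which go to block `j`. If there are two of them, `A` maps a nonzero difference in `V i`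
to a nonzero element of `V j`; such pairs are rare, because subfields of coprime degrees over the
prime field meet in the prime field only, which meets each `V i` in zero.

* If `A` lies in the field of some `V k`, only `i = j` is possible. If `A` is not in the prime
  field, then also `i = k`; if it is, `B = (1 - A) * β i + v` with `v` in `V i` determines `i`. So
  only one block is kept, and a block has `p ^ (t 0 - 2)` points.
* Otherwise `i ≠ j`, the pair is determined by `A` up to the order, and the points lie on a line
  over the prime field. There are at most two such lines, and `2 * p ≤ p ^ (t 0 - 2)`.

The remaining pairs contribute at most one point each. Membership in subfields is expressed by
powers of the Frobenius: an element fixed by its `a`-th and its `b`-th power is fixed by its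
`gcd a b`-th power.

For the length, `log n` is asymptotic to `t 0 * log p`, while `log q = T * log p` with
`T = t 0 * ⋯ * t (m - 1)`. Bertrand's postulate gives `t 0 ^ m ≤ T ≤ C * t 0 ^ m` for consecutive
primes, which settles a fixed characteristic. For a given exponent `ε > 1 / m`, the equation
`t 0 * L = (T * L) ^ ε` has the solution `L = (T ^ ε / t 0) ^ (1 / (1 - ε))`, which tends to
infinity, and again by Bertrand's postulate there is a prime `p` with `log p` within `log 4`
of `L`.
-/

/-! ### Insdel distance and common subsequences -/

/-- `k` edits leave a common subsequence of all but at most `k` of the letters of both words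
together: an insertion preserves it, a deletion costs it at most one letter. -/
theorem InsdelSteps.exists_common_sublist {A : Type*} {k : ℕ} {u v : List A}
    (h : InsdelSteps k u v) :
    ∃ w : List A, w.Sublist u ∧ w.Sublist v ∧ u.length + v.length ≤ k + 2 * w.length := by
  induction h with
  | refl u => exact ⟨u, List.Sublist.refl u, List.Sublist.refl u, by omega⟩
  | tail _ hstep ih =>
    obtain ⟨w, hwu, hwv, hlen⟩ := ih
    cases hstep with
    | insertion x y a =>
      refine ⟨w, hwu, hwv.trans ((List.Sublist.refl x).append (List.sublist_cons_self a y)), ?_⟩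
      simp only [List.length_append, List.length_cons] at hlen ⊢
      omega
    | deletion x y a =>
      obtain ⟨w₁, w₂, rfl, h₁, h₂⟩ := List.sublist_append_iff.1 hwv
      rcases List.sublist_cons_iff.1 h₂ with h₂ | ⟨r, rfl, hr⟩
      · refine ⟨w₁ ++ w₂, hwu, h₁.append h₂, ?_⟩
        simp only [List.length_append, List.length_cons] at hlen ⊢
        omega
      · refine ⟨w₁ ++ r, ?_, h₁.append hr, ?_⟩
        · exact ((List.Sublist.refl w₁).append (List.sublist_cons_self a r)).trans hwu
        · simp only [List.length_append, List.length_cons] at hlen ⊢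
          omega

theorem exists_insdelSteps {A : Type*} (u v : List A) : ∃ k, InsdelSteps k u v := by
  have delete : ∀ x : List A, (∃ k, InsdelSteps k u x) → ∃ k, InsdelSteps k u [] := by
    intro x
    induction x with
    | nil => exact id
    | cons a x ih => exact fun ⟨k, hk⟩ => ih ⟨k + 1, hk.tail (InsdelStep.deletion [] x a)⟩
  induction v with
  | nil => exact delete u ⟨0, InsdelSteps.refl u⟩
  | cons a v ih =>
    obtain ⟨k, hk⟩ := ih
    exact ⟨k + 1, hk.tail (InsdelStep.insertion [] v a)⟩

theorem exists_common_sublist_insdelDist {A : Type*} (u v : List A) :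
    ∃ w : List A, w.Sublist u ∧ w.Sublist v ∧
      u.length + v.length ≤ insdelDist u v + 2 * w.length :=
  (Nat.sInf_mem (exists_insdelSteps u v) : InsdelSteps _ u v).exists_common_sublist

/-- A common subsequence without repetitions is no longer than the set of common letters. -/
theorem two_mul_le_insdelDist_ofFn {A : Type*} {n : ℕ} {f g : Fin n → A}
    (h : Function.Injective f ∨ Function.Injective g ∨
      Disjoint (Set.range f) (Set.range g)) :
    2 * n ≤ insdelDist (List.ofFn f) (List.ofFn g) +
      2 * (Set.range f ∩ Set.range g).ncard := by
  classical
  obtain ⟨w, hf, hg, hlen⟩ := exists_common_sublist_insdelDist (List.ofFn f) (List.ofFn g)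
  have hmem : ∀ x ∈ w, x ∈ Set.range f ∩ Set.range g := fun x hx =>
    ⟨(List.mem_ofFn' _ _).1 (hf.subset hx), (List.mem_ofFn' _ _).1 (hg.subset hx)⟩
  have hnodup : w.Nodup := by
    rcases h with h | h | h
    · exact hf.nodup (List.nodup_ofFn.2 h)
    · exact hg.nodup (List.nodup_ofFn.2 h)
    · rw [List.eq_nil_iff_forall_not_mem.2 fun x hx =>
        Set.disjoint_left.1 h (hmem x hx).1 (hmem x hx).2]
      exact List.nodup_nil
  have hcard : w.length ≤ (Set.range f ∩ Set.range g).ncard := by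
    rw [← List.toFinset_card_of_nodup hnodup, ← Set.ncard_coe_finset]
    exact Set.ncard_le_ncard (fun x hx => hmem x (by simpa using hx))
      ((Set.finite_range f).inter_of_left _)
  simp only [List.length_ofFn] at hlen
  omega

/-! ### Elements fixed by a power of the Frobenius -/

section Frobenius

variable {p : ℕ} [Fact p.Prime] {F : Type*} [Field F] [Algebra (ZMod p) F]

variable (p F) in
/-- The subfield of the elements with `x ^ p ^ n = x`. If `F` contains a field with `p ^ n`
elements and `n ≠ 0`, it is that field; for `n = 0` it is all of `F`. -/
def frobeniusFixed (n : ℕ) : IntermediateField (ZMod p) F where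
  carrier := {x | x ^ p ^ n = x}
  mul_mem' {x y} hx hy := by
    rw [Set.mem_ofPred_eq] at *
    rw [mul_pow, hx, hy]
  add_mem' {x y} hx hy := by
    have : CharP F p := charP_of_injective_algebraMap (algebraMap (ZMod p) F).injective p
    rw [Set.mem_ofPred_eq] at *
    rw [add_pow_char_pow, hx, hy]
  algebraMap_mem' c := by
    rw [Set.mem_ofPred_eq, ← map_pow, ZMod.pow_card_pow]
  inv_mem' x hx := by
    rw [Set.mem_ofPred_eq] at *
    rw [inv_pow, hx]

theorem mem_frobeniusFixed {n : ℕ} {x : F} : x ∈ frobeniusFixed p F n ↔ x ^ p ^ n = x :=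
  Iff.rfl

theorem mem_frobeniusFixed_iff_isPeriodicPt {n : ℕ} {x : F} :
    x ∈ frobeniusFixed p F n ↔ Function.IsPeriodicPt (fun y : F => y ^ p) n x := by
  rw [mem_frobeniusFixed, Function.IsPeriodicPt, Function.IsFixedPt, pow_iterate]

theorem frobeniusFixed_mono {m n : ℕ} (h : m ∣ n) :
    frobeniusFixed p F m ≤ frobeniusFixed p F n := fun _ hx =>
  mem_frobeniusFixed_iff_isPeriodicPt.2 ((mem_frobeniusFixed_iff_isPeriodicPt.1 hx).trans_dvd h)

theorem mem_frobeniusFixed_one_of_coprime {m n : ℕ} (h : m.Coprime n) {x : F}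
    (hm : x ∈ frobeniusFixed p F m) (hn : x ∈ frobeniusFixed p F n) :
    x ∈ frobeniusFixed p F 1 := by
  rw [mem_frobeniusFixed_iff_isPeriodicPt] at *
  rw [← Nat.coprime_iff_gcd_eq_one.1 h]
  exact hm.gcd hn

theorem exists_algebraMap_of_mem_frobeniusFixed_one {x : F} (hx : x ∈ frobeniusFixed p F 1) :
    ∃ c : ZMod p, algebraMap (ZMod p) F c = x := by
  have : CharP F p := charP_of_injective_algebraMap (algebraMap (ZMod p) F).injective p
  rw [mem_frobeniusFixed, pow_one, ← Subfield.mem_bot_iff_pow_eq_self,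
    mem_bot_iff_intCast p] at hx
  obtain ⟨n, rfl⟩ := hx
  exact ⟨n, map_intCast _ n⟩

theorem mem_frobeniusFixed_of_card_adjoin {n : ℕ} {β : F}
    (h : Nat.card ((ZMod p)⟮β⟯) = p ^ n) : β ∈ frobeniusFixed p F n := by
  have hpos : 0 < Nat.card ((ZMod p)⟮β⟯) := by
    rw [h]
    exact pow_pos (Fact.out : p.Prime).pos n
  have : Finite ((ZMod p)⟮β⟯) := (Nat.card_pos_iff.1 hpos).2
  have : Fintype ((ZMod p)⟮β⟯) := Fintype.ofFinite _
  have hpow := FiniteField.pow_card (⟨β, IntermediateField.mem_adjoin_simple_self _ β⟩ : (ZMod p)⟮β⟯)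
  rw [← Nat.card_eq_fintype_card, h] at hpow
  exact congrArg Subtype.val hpow

theorem natDegree_minpoly_of_card_adjoin [Finite F] {n : ℕ} {β : F}
    (h : Nat.card ((ZMod p)⟮β⟯) = p ^ n) : (minpoly (ZMod p) β).natDegree = n := by
  have hβ : IsIntegral (ZMod p) β := Algebra.IsIntegral.isIntegral β
  rw [← IntermediateField.adjoin.finrank hβ]
  refine Nat.pow_right_injective (Fact.out : p.Prime).two_le ?_
  simp only
  rw [FiniteField.pow_finrank_eq_natCard p, h]

/-- A field with `p ^ N` elements has a generator of a subfield with `p ^ n` elements for each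
divisor `n` of `N`. -/
theorem exists_card_adjoin_eq [Finite F] {n N : ℕ} (hn : n ≠ 0) (hnN : n ∣ N)
    (hF : Nat.card F = p ^ N) : ∃ β : F, Nat.card ((ZMod p)⟮β⟯) = p ^ n := by
  have hfin : Finite (GaloisField p n) :=
    (Nat.card_pos_iff.1 (by rw [GaloisField.card p n hn]; exact pow_pos (Fact.out : p.Prime).pos n)).2
  have hrank : Module.finrank (ZMod p) F = N := by
    refine Nat.pow_right_injective (Fact.out : p.Prime).two_le ?_
    simp only
    rw [FiniteField.pow_finrank_eq_natCard p, hF]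
  obtain ⟨φ⟩ := FiniteField.nonempty_algHom_of_finrank_dvd
    (F := ZMod p) (K := GaloisField p n) (L := F) (by rwa [GaloisField.finrank p hn, hrank])
  obtain ⟨γ, hγ⟩ := Field.exists_primitive_element (ZMod p) (GaloisField p n)
  refine ⟨φ γ, ?_⟩
  have hmap : (ZMod p)⟮φ γ⟯ = φ.fieldRange := by
    rw [AlgHom.fieldRange_eq_map, ← hγ, IntermediateField.adjoin_map, Set.image_singleton]
  rw [hmap, ← GaloisField.card p n hn]
  exact (Nat.card_congr (AlgEquiv.ofInjectiveField φ).toEquiv).symm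

end Frobenius

/-! ### The span of the higher powers of a generator -/

section Span

variable {p : ℕ} [Fact p.Prime] {F : Type*} [Field F] [Algebra (ZMod p) F]

variable (p) in
/-- The direction of `affineBlock p r β`: the span of `β ^ 2, …, β ^ (r - 1)`. -/
def powerSpan (r : ℕ) (β : F) : Submodule (ZMod p) F :=
  Submodule.span (ZMod p) ((fun j : ℕ => β ^ j) '' Set.Icc 2 (r - 1))

theorem mem_affineBlock {r : ℕ} {β x : F} : x ∈ affineBlock p r β ↔ x - β ∈ powerSpan p r β := by
  constructor
  · rintro ⟨y, hy, rfl⟩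
    rwa [add_sub_cancel_left]
  · exact fun h => ⟨x - β, h, by ring⟩

theorem linearIndepOn_pow {r : ℕ} {β : F} (hr : r ≤ (minpoly (ZMod p) β).natDegree) :
    LinearIndepOn (ZMod p) (fun j : ℕ => β ^ j) (Set.Iio r) :=
  (linearIndependent_pow β).comp (fun j : Set.Iio r => ⟨j, lt_of_lt_of_le j.2 hr⟩)
    fun _ _ h => Subtype.ext (Fin.mk.inj_iff.1 h)

theorem powerSpan_le {r : ℕ} {β : F} {K : IntermediateField (ZMod p) F} (h : β ∈ K) :
    powerSpan p r β ≤ K.toSubalgebra.toSubmodule := by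
  rw [powerSpan, Submodule.span_le]
  rintro _ ⟨j, -, rfl⟩
  exact pow_mem h j

theorem natCard_powerSpan {r : ℕ} {β : F} (hr : r ≤ (minpoly (ZMod p) β).natDegree) :
    Nat.card (powerSpan p r β) = p ^ (r - 2) := by
  have hli : LinearIndepOn (ZMod p) (fun j : ℕ => β ^ j) (Set.Icc 2 (r - 1)) :=
    (linearIndepOn_pow hr).mono fun j hj => by
      simp only [Set.mem_Icc, Set.mem_Iio] at hj ⊢
      omega
  have hrank : Module.finrank (ZMod p) (powerSpan p r β) = r - 2 := by
    rw [powerSpan, Set.image_eq_range, finrank_span_eq_card hli]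
    simp only [Fintype.card_ofFinset, Nat.card_Icc]
    simp
    omega
  have : Module.Finite (ZMod p) (powerSpan p r β) :=
    Module.Finite.span_of_finite _ ((Set.finite_Icc _ _).image _)
  rw [Module.natCard_eq_pow_finrank (K := ZMod p), hrank, Nat.card_zmod]

/-- Since `1, β, …, β ^ (r - 1)` are independent, a point `c • β + v` over the direction of the
block lies in the prime field only if it vanishes term by term. -/
theorem eq_zero_of_smul_add_mem_frobeniusFixed_one {r : ℕ} {β : F} (h₂ : 2 ≤ r)
    (hr : r ≤ (minpoly (ZMod p) β).natDegree) {c : ZMod p} {v : F} (hv : v ∈ powerSpan p r β)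
    (h : c • β + v ∈ frobeniusFixed p F 1) : c = 0 ∧ v = 0 := by
  have hli := linearIndepOn_pow hr
  obtain ⟨d, hd⟩ := exists_algebraMap_of_mem_frobeniusFixed_one h
  have hβ : β ∈ Submodule.span (ZMod p) ((fun j : ℕ => β ^ j) '' {1}) := by simp
  have hsum : c • β + v ∈ Submodule.span (ZMod p) ((fun j : ℕ => β ^ j) '' Set.Icc 1 (r - 1)) := by
    refine add_mem (Submodule.smul_mem _ _ (Submodule.span_mono (Set.image_mono ?_) hβ))
      (Submodule.span_mono (Set.image_mono (Set.Icc_subset_Icc_left one_le_two)) hv)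
    simp only [Set.singleton_subset_iff, Set.mem_Icc]
    omega
  have hconst : c • β + v ∈ Submodule.span (ZMod p) ((fun j : ℕ => β ^ j) '' {0}) := by
    rw [← hd, Algebra.algebraMap_eq_smul_one]
    exact Submodule.smul_mem _ _ (Submodule.subset_span (by simp))
  have hdisj : ∀ s u : Set ℕ, s ⊆ Set.Iio r → u ⊆ Set.Iio r → Disjoint s u → ∀ x : F,
      x ∈ Submodule.span (ZMod p) ((fun j : ℕ => β ^ j) '' s) →
      x ∈ Submodule.span (ZMod p) ((fun j : ℕ => β ^ j) '' u) → x = 0 := by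
    intro s u hs hu hsu x hxs hxu
    have hunion := hli.mono (Set.union_subset hs hu)
    exact Submodule.disjoint_def.1
      ((linearIndepOn_union_iff hsu).1 hunion).2.2 x hxs hxu
  have hzero : c • β + v = 0 := by
    refine hdisj {0} (Set.Icc 1 (r - 1)) ?_ ?_ (by simp) _ hconst hsum
    · simp only [Set.singleton_subset_iff, Set.mem_Iio]
      omega
    · intro j hj
      simp only [Set.mem_Icc, Set.mem_Iio] at hj ⊢
      omega
  have hv₀ : v = 0 := by
    refine hdisj {1} (Set.Icc 2 (r - 1)) ?_ ?_ (by simp) v ?_ hv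
    · simp only [Set.singleton_subset_iff, Set.mem_Iio]
      omega
    · intro j hj
      simp only [Set.mem_Icc, Set.mem_Iio] at hj ⊢
      omega
    · rw [eq_neg_of_add_eq_zero_right hzero]
      exact neg_mem (Submodule.smul_mem _ _ hβ)
  have hβ₀ : β ≠ 0 := by
    have := hli.ne_zero (i := 1) (by simp only [Set.mem_Iio]; omega)
    simpa using this
  rw [hv₀, add_zero, smul_eq_zero] at hzero
  exact ⟨hzero.resolve_right hβ₀, hv₀⟩

end Span

/-! ### Affine maps between blocks -/

/-- The blocks `β i + V i` lie in subfields with `p ^ t i` elements, for distinct primes `t i`, and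
the prime field meets the span of `β i` and `V i` trivially. This is all that the count of the
points which an affine map sends from blocks into blocks depends on. -/
structure IsBlockFamily (p : ℕ) [Fact p.Prime] {F : Type*} [Field F] [Algebra (ZMod p) F]
    {ι : Type*} (t : ι → ℕ) (β : ι → F) (V : ι → Submodule (ZMod p) F) : Prop where
  prime : ∀ i, (t i).Prime
  injective : Function.Injective t
  base_mem : ∀ i, β i ∈ frobeniusFixed p F (t i)
  direction_mem : ∀ i, ∀ v ∈ V i, v ∈ frobeniusFixed p F (t i)
  eq_zero : ∀ i (c : ZMod p), ∀ v ∈ V i, c • β i + v ∈ frobeniusFixed p F 1 → c = 0 ∧ v = 0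

/-- The points of the block `b + V` which `x ↦ A * x + B` sends into the block `c + W`. -/
def transferSet {k F : Type*} [Field k] [Field F] [Algebra k F] (A B b c : F)
    (V W : Submodule k F) : Set F :=
  {x | x - b ∈ V ∧ A * x + B - c ∈ W}

theorem sub_mem_of_mem_transferSet {k F : Type*} [Field k] [Field F] [Algebra k F] {A B b c : F}
    {V W : Submodule k F} {x y : F} (hx : x ∈ transferSet A B b c V W)
    (hy : y ∈ transferSet A B b c V W) : x - y ∈ V ∧ A * (x - y) ∈ W := by
  constructor
  · simpa using sub_mem hx.1 hy.1
  · have := sub_mem hx.2 hy.2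
    rwa [show A * x + B - c - (A * y + B - c) = A * (x - y) by ring] at this

namespace IsBlockFamily

variable {p : ℕ} [Fact p.Prime] {F : Type*} [Field F] [Algebra (ZMod p) F] {ι : Type*}
  {t : ι → ℕ} {β : ι → F} {V : ι → Submodule (ZMod p) F}

theorem coprime (h : IsBlockFamily p t β V) {i j : ι} (hij : i ≠ j) : (t i).Coprime (t j) :=
  (Nat.coprime_primes (h.prime i) (h.prime j)).2 (h.injective.ne hij)

theorem eq_zero_of_mem (h : IsBlockFamily p t β V) {i : ι} {n : ℕ} (hn : (t i).Coprime n) {v : F}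
    (hv : v ∈ V i) (hvn : v ∈ frobeniusFixed p F n) : v = 0 := by
  refine (h.eq_zero i 0 v hv ?_).2
  rw [zero_smul, zero_add]
  exact mem_frobeniusFixed_one_of_coprime hn (h.direction_mem i v hv) hvn

theorem block_mem (h : IsBlockFamily p t β V) {i : ι} {x : F} (hx : x - β i ∈ V i) :
    x ∈ frobeniusFixed p F (t i) := by
  have := add_mem (h.direction_mem i _ hx) (h.base_mem i)
  rwa [sub_add_cancel] at this

theorem disjoint_blocks (h : IsBlockFamily p t β V) {i j : ι} (hij : i ≠ j) {x : F}
    (hi : x - β i ∈ V i) (hj : x - β j ∈ V j) : False := by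
  have hone := mem_frobeniusFixed_one_of_coprime (h.coprime hij) (h.block_mem hi) (h.block_mem hj)
  refine one_ne_zero (h.eq_zero i 1 _ hi ?_).1
  rwa [one_smul, add_sub_cancel]

/-- If `A` lies in a subfield whose degree is prime to `t i`, then so does `v = (A * v) / A`, after
`t j` has been included in that degree; but a direction of the `i`-th block in such a subfield
vanishes. -/
theorem eq_zero_of_mul_mem (h : IsBlockFamily p t β V) {i j : ι} (hij : i ≠ j) {n : ℕ}
    (hn : (t i).Coprime n) {A v : F} (hA₀ : A ≠ 0) (hA : A ∈ frobeniusFixed p F n)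
    (hv : v ∈ V i) (hAv : A * v ∈ V j) : v = 0 := by
  refine h.eq_zero_of_mem (Nat.Coprime.mul_right (h.coprime hij) hn) hv ?_
  have h₁ := frobeniusFixed_mono (dvd_mul_right (t j) n) (h.direction_mem j _ hAv)
  have h₂ := frobeniusFixed_mono (dvd_mul_left n (t j)) hA
  have := div_mem h₁ h₂
  rwa [mul_div_cancel_left₀ _ hA₀] at this

theorem eq_zero_of_mul_mem' (h : IsBlockFamily p t β V) {i j : ι} (hij : i ≠ j) {n : ℕ}
    (hn : (t j).Coprime n) {A v : F} (hA₀ : A ≠ 0) (hA : A ∈ frobeniusFixed p F n)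
    (hv : v ∈ V i) (hAv : A * v ∈ V j) : v = 0 := by
  have := h.eq_zero_of_mul_mem hij.symm hn (inv_ne_zero hA₀) (inv_mem hA) hAv
    (by rwa [inv_mul_cancel_left₀ hA₀])
  exact (mul_eq_zero.1 this).resolve_left hA₀

theorem mem_of_mul_mem (h : IsBlockFamily p t β V) {i j : ι} {A v : F} (hv₀ : v ≠ 0)
    (hv : v ∈ V i) (hAv : A * v ∈ V j) : A ∈ frobeniusFixed p F (t i * t j) := by
  have h₁ := frobeniusFixed_mono (dvd_mul_right (t i) (t j)) (h.direction_mem i _ hv)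
  have h₂ := frobeniusFixed_mono (dvd_mul_left (t j) (t i)) (h.direction_mem j _ hAv)
  have := div_mem h₂ h₁
  rwa [mul_div_cancel_right₀ _ hv₀] at this

theorem mem_of_mul_mem_self (h : IsBlockFamily p t β V) {i : ι} {A v : F} (hv₀ : v ≠ 0)
    (hv : v ∈ V i) (hAv : A * v ∈ V i) : A ∈ frobeniusFixed p F (t i) := by
  have := div_mem (h.direction_mem i _ hAv) (h.direction_mem i _ hv)
  rwa [mul_div_cancel_right₀ _ hv₀] at this

/-- A multiplier from a subfield with `p ^ t k` elements does not relate two different blocks. -/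
theorem eq_of_mul_mem (h : IsBlockFamily p t β V) {i j k : ι} {A v : F} (hA₀ : A ≠ 0)
    (hA : A ∈ frobeniusFixed p F (t k)) (hv₀ : v ≠ 0) (hv : v ∈ V i) (hAv : A * v ∈ V j) :
    i = j := by
  by_contra hij
  by_cases hik : i = k
  · subst hik
    exact hv₀ (h.eq_zero_of_mul_mem' hij (h.coprime (Ne.symm hij)) hA₀ hA hv hAv)
  · exact hv₀ (h.eq_zero_of_mul_mem hij (h.coprime hik) hA₀ hA hv hAv)

/-- A multiplier relates at most one unordered pair of different blocks. -/
theorem pair_eq_of_mul_mem (h : IsBlockFamily p t β V) {i j k l : ι} (hkl : k ≠ l)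
    {A v w : F} (hA₀ : A ≠ 0) (hv₀ : v ≠ 0) (hv : v ∈ V i) (hAv : A * v ∈ V j)
    (hw₀ : w ≠ 0) (hw : w ∈ V k) (hAw : A * w ∈ V l) :
    (k, l) = (i, j) ∨ (k, l) = (j, i) := by
  have hA := h.mem_of_mul_mem hv₀ hv hAv
  have hk : k = i ∨ k = j := by
    by_contra! hk
    exact hw₀ (h.eq_zero_of_mul_mem hkl
      (Nat.Coprime.mul_right (h.coprime hk.1) (h.coprime hk.2)) hA₀ hA hw hAw)
  have hl : l = i ∨ l = j := by
    by_contra! hl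
    exact hw₀ (h.eq_zero_of_mul_mem' hkl
      (Nat.Coprime.mul_right (h.coprime hl.1) (h.coprime hl.2)) hA₀ hA hw hAw)
  grind

/-- The differences of the points sent from one block into a different one are multiples of one
of them by elements of the intersection of the two subfields, the prime field. -/
theorem ncard_transferSet_le (h : IsBlockFamily p t β V) {i j : ι} (hij : i ≠ j) {A B : F}
    (hA₀ : A ≠ 0) : (transferSet A B (β i) (β j) (V i) (V j)).ncard ≤ p := by
  set M := transferSet A B (β i) (β j) (V i) (V j)
  rcases M.subsingleton_or_nontrivial with hM | ⟨x, hx, y, hy, hxy⟩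
  · have := hM.finite.to_subtype
    exact (Set.ncard_le_one_iff_subsingleton.2 hM).trans (Fact.out : p.Prime).one_le
  · have hsub : M ⊆ Set.range fun c : ZMod p => x + algebraMap (ZMod p) F c * (y - x) := by
      intro z hz
      obtain ⟨hv, hAv⟩ := sub_mem_of_mem_transferSet hy hx
      obtain ⟨hw, hAw⟩ := sub_mem_of_mem_transferSet hz hx
      have hyx : y - x ≠ 0 := sub_ne_zero.2 (Ne.symm hxy)
      have hi := div_mem (h.direction_mem i _ hw) (h.direction_mem i _ hv)
      have hj := div_mem (h.direction_mem j _ hAw) (h.direction_mem j _ hAv)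
      rw [mul_div_mul_left _ _ hA₀] at hj
      obtain ⟨c, hc⟩ := exists_algebraMap_of_mem_frobeniusFixed_one
        (mem_frobeniusFixed_one_of_coprime (h.coprime hij) hi hj)
      refine ⟨c, ?_⟩
      simp only [hc, div_mul_cancel₀ _ hyx]
      ring
    calc M.ncard ≤ _ := Set.ncard_le_ncard hsub (Set.finite_range _)
      _ ≤ Nat.card (ZMod p) := by
        rw [← Set.image_univ, ← Set.ncard_univ]
        exact Set.ncard_image_le
      _ = p := Nat.card_zmod p

/-- A nontrivial affine map with multiplier in the prime field sends a point of a block to a point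
of the same block for at most one block. -/
theorem eq_of_mem_transferSet (h : IsBlockFamily p t β V) {A B : F}
    (hA : A ∈ frobeniusFixed p F 1) (hAB : ¬(A = 1 ∧ B = 0)) {i j : ι} {x y : F}
    (hx : x ∈ transferSet A B (β i) (β i) (V i) (V i))
    (hy : y ∈ transferSet A B (β j) (β j) (V j) (V j)) : i = j := by
  by_contra hij
  obtain ⟨a, ha⟩ := exists_algebraMap_of_mem_frobeniusFixed_one hA
  -- The translation part is `B = (1 - A) * β + v` for each of the two blocks.
  have key : ∀ k z, z ∈ transferSet A B (β k) (β k) (V k) (V k) →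
      ∃ v ∈ V k, B = (1 - a) • β k + v := by
    intro k z hz
    refine ⟨A * z + B - β k - a • (z - β k), sub_mem hz.2 (Submodule.smul_mem _ _ hz.1), ?_⟩
    rw [Algebra.smul_def, Algebra.smul_def, map_sub, map_one, ha]
    ring
  have hB : ∀ k z, z ∈ transferSet A B (β k) (β k) (V k) (V k) →
      B ∈ frobeniusFixed p F (t k) := by
    intro k z hz
    obtain ⟨v, hv, hBv⟩ := key k z hz
    rw [hBv]
    exact add_mem (IntermediateField.smul_mem _ (h.base_mem k)) (h.direction_mem k v hv)
  have hone := mem_frobeniusFixed_one_of_coprime (h.coprime hij) (hB i x hx) (hB j y hy)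
  obtain ⟨v, hv, hBv⟩ := key i x hx
  rw [hBv] at hone
  obtain ⟨ha₁, hv₀⟩ := h.eq_zero i _ v hv hone
  refine hAB ⟨?_, ?_⟩
  · rw [← ha, ← sub_eq_zero.1 ha₁, map_one]
  · rw [hBv, ha₁, hv₀, zero_smul, zero_add]

end IsBlockFamily

theorem ncard_setOf_sub_mem {k F : Type*} [Ring k] [AddCommGroup F] [Module k F] (V : Submodule k F)
    (b : F) : {x | x - b ∈ V}.ncard = Nat.card V := by
  have : {x | x - b ∈ V} = (fun v => v + b) '' (V : Set F) := by
    ext x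
    simp [sub_eq_add_neg]
  rw [this, Set.ncard_image_of_injective _ (add_left_injective _)]
  rfl

theorem sum_le_of_card_mul_le {κ : Type*} [Fintype κ] {f : κ → ℕ} {b N : ℕ}
    (hb : ∀ e, 1 < f e → f e ≤ b) (hN : (Finset.univ.filter fun e => 1 < f e).card * b ≤ N) :
    ∑ e, f e ≤ N + Fintype.card κ := by
  rw [← Finset.sum_filter_add_sum_filter_not Finset.univ fun e => 1 < f e]
  refine add_le_add (le_trans ?_ hN) ?_
  · rw [← smul_eq_mul]
    exact Finset.sum_le_card_nsmul _ _ _ fun e he => hb e (Finset.mem_filter.1 he).2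
  · refine (Finset.sum_le_card_nsmul _ _ 1 fun e he => not_lt.1 (Finset.mem_filter.1 he).2).trans ?_
    rw [smul_eq_mul, mul_one]
    exact Finset.card_le_univ _

namespace IsBlockFamily

variable {p : ℕ} [Fact p.Prime] {F : Type*} [Field F] [Finite F] [Algebra (ZMod p) F]
  {ι : Type*} [Fintype ι] {t : ι → ℕ} {β : ι → F} {V : ι → Submodule (ZMod p) F} {N : ℕ}

theorem ncard_iUnion_blocks (h : IsBlockFamily p t β V) (hN : ∀ i, Nat.card (V i) = N) :
    (⋃ i, {x | x - β i ∈ V i}).ncard = Fintype.card ι * N := by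
  rw [Set.ncard_iUnion_of_finite (fun i => Set.toFinite _)]
  · rw [finsum_eq_sum_of_fintype]
    simp [ncard_setOf_sub_mem, hN]
  · intro i j hij
    exact Set.disjoint_left.2 fun x hi hj => h.disjoint_blocks hij hi hj

/-- A nontrivial affine map keeps at most about one block's worth of points in the union of the
blocks. Apart from single points for each pair of blocks, it can keep
* one block, if its multiplier lies in a subfield with `p ^ t k` elements;
* two lines over the prime field otherwise. -/
theorem ncard_affine_le (h : IsBlockFamily p t β V) (hN : ∀ i, Nat.card (V i) = N)
    (hp : 2 * p ≤ N) {A B : F} (hA₀ : A ≠ 0) (hAB : ¬(A = 1 ∧ B = 0)) :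
    {x | (∃ i, x - β i ∈ V i) ∧ ∃ j, A * x + B - β j ∈ V j}.ncard ≤
      N + Fintype.card ι ^ 2 := by
  classical
  set M : ι × ι → Set F := fun e => transferSet A B (β e.1) (β e.2) (V e.1) (V e.2) with hM
  have hunion : {x | (∃ i, x - β i ∈ V i) ∧ ∃ j, A * x + B - β j ∈ V j} = ⋃ e, M e := by
    ext x
    simp [hM, transferSet]
  have hMN : ∀ e, (M e).ncard ≤ N := fun e => by
    rw [← hN e.1, ← ncard_setOf_sub_mem (V e.1) (β e.1)]
    exact Set.ncard_le_ncard (fun x hx => hx.1)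
  have hheavy : ∀ e, 1 < (M e).ncard → ∃ v, v ≠ 0 ∧ v ∈ V e.1 ∧ A * v ∈ V e.2 := by
    intro e he
    obtain ⟨x, hx, y, hy, hxy⟩ := Set.one_lt_ncard_iff_nontrivial.1 he
    exact ⟨x - y, sub_ne_zero.2 hxy, sub_mem_of_mem_transferSet hx hy⟩
  have hnonempty : ∀ e, 1 < (M e).ncard → (M e).Nonempty := fun e he =>
    Set.nonempty_of_ncard_ne_zero (by omega)
  have hcard : Fintype.card (ι × ι) = Fintype.card ι ^ 2 := by rw [Fintype.card_prod, sq]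
  have hsum : (⋃ e, M e).ncard ≤ ∑ e, (M e).ncard := Set.ncard_iUnion_le_of_fintype M
  rw [hunion, ← hcard]
  refine hsum.trans ?_
  by_cases hA : ∃ k, A ∈ frobeniusFixed p F (t k)
  · obtain ⟨k, hk⟩ := hA
    refine sum_le_of_card_mul_le (b := N) (fun e _ => hMN e) ?_
    refine (Nat.mul_le_mul_right N (Finset.card_le_one.2 ?_)).trans_eq (one_mul N)
    rintro ⟨i, i'⟩ hi ⟨j, j'⟩ hj
    replace hi := (Finset.mem_filter.1 hi).2
    replace hj := (Finset.mem_filter.1 hj).2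
    obtain ⟨v, hv₀, hv, hAv⟩ := hheavy _ hi
    obtain ⟨w, hw₀, hw, hAw⟩ := hheavy _ hj
    obtain rfl : i = i' := h.eq_of_mul_mem hA₀ hk hv₀ hv hAv
    obtain rfl : j = j' := h.eq_of_mul_mem hA₀ hk hw₀ hw hAw
    suffices i = j by rw [this]
    by_contra hij
    have hone := mem_frobeniusFixed_one_of_coprime (h.coprime hij)
      (h.mem_of_mul_mem_self hv₀ hv hAv) (h.mem_of_mul_mem_self hw₀ hw hAw)
    obtain ⟨x, hx⟩ := hnonempty _ hi
    obtain ⟨y, hy⟩ := hnonempty _ hj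
    exact hij (h.eq_of_mem_transferSet hone hAB hx hy)
  · have hne : ∀ i j, 1 < (M (i, j)).ncard → i ≠ j := by
      rintro i _ hi rfl
      obtain ⟨v, hv₀, hv, hAv⟩ := hheavy _ hi
      exact hA ⟨i, h.mem_of_mul_mem_self hv₀ hv hAv⟩
    refine sum_le_of_card_mul_le (b := p) (fun e he => ?_) ?_
    · exact h.ncard_transferSet_le (hne e.1 e.2 he) hA₀
    refine (Nat.mul_le_mul_right p ?_).trans hp
    rcases (Finset.univ.filter fun e => 1 < (M e).ncard).eq_empty_or_nonempty with he | ⟨⟨i, j⟩, hij⟩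
    · rw [he]
      simp
    · replace hij := (Finset.mem_filter.1 hij).2
      obtain ⟨v, hv₀, hv, hAv⟩ := hheavy _ hij
      refine (Finset.card_le_card (t := {(i, j), (j, i)}) ?_).trans Finset.card_le_two
      rintro ⟨k, l⟩ hkl
      replace hkl := (Finset.mem_filter.1 hkl).2
      obtain ⟨w, hw₀, hw, hAw⟩ := hheavy _ hkl
      simpa using h.pair_eq_of_mul_mem (hne _ _ hkl) hA₀ hv₀ hv hAv hw₀ hw hAw

end IsBlockFamily

/-! ### Asymptotics of the length -/

theorem prime_consecutivePrimes (a i : ℕ) : (consecutivePrimes a i).Prime :=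
  Nat.prime_nth_prime _

theorem consecutivePrimes_succ_le (a i : ℕ) :
    consecutivePrimes a (i + 1) ≤ 2 * consecutivePrimes a i := by
  obtain ⟨q, hq, hlt, hle⟩ :=
    Nat.exists_prime_lt_and_le_two_mul _ (prime_consecutivePrimes a i).ne_zero
  refine le_trans ?_ hle
  obtain ⟨k, -, rfl⟩ := Nat.exists_lt_card_nth_eq hq
  have hk : a + i < k := (Nat.nth_lt_nth Nat.infinite_setOfPred_prime).1 hlt
  exact (Nat.nth_le_nth Nat.infinite_setOfPred_prime).2 hk

theorem consecutivePrimes_le (a i : ℕ) :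
    consecutivePrimes a i ≤ 2 ^ i * consecutivePrimes a 0 := by
  induction i with
  | zero => simp
  | succ i ih =>
    calc _ ≤ 2 * consecutivePrimes a i := consecutivePrimes_succ_le a i
      _ ≤ 2 * (2 ^ i * consecutivePrimes a 0) := by gcongr
      _ = _ := by ring

theorem le_consecutivePrimes (a i : ℕ) : consecutivePrimes a 0 ≤ consecutivePrimes a i :=
  (Nat.nth_le_nth Nat.infinite_setOfPred_prime).2 (by omega)

theorem tendsto_consecutivePrimes :
    Filter.Tendsto (fun a => (consecutivePrimes a 0 : ℝ)) Filter.atTop Filter.atTop := by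
  refine tendsto_natCast_atTop_atTop.comp ?_
  exact (Nat.nth_strictMono Nat.infinite_setOfPred_prime).tendsto_atTop

theorem pow_le_prod_consecutivePrimes (a m : ℕ) :
    (consecutivePrimes a 0 : ℝ) ^ m ≤ ∏ i ∈ Finset.range m, (consecutivePrimes a i : ℝ) := by
  have := Finset.prod_le_prod' (s := Finset.range m) fun i _ => le_consecutivePrimes a i
  simp only [Finset.prod_const, Finset.card_range] at this
  exact_mod_cast this

theorem prod_consecutivePrimes_le (a m : ℕ) :
    ∏ i ∈ Finset.range m, (consecutivePrimes a i : ℝ) ≤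
      (∏ i ∈ Finset.range m, (2 : ℝ) ^ i) * (consecutivePrimes a 0 : ℝ) ^ m := by
  have := Finset.prod_le_prod' (s := Finset.range m) fun i _ => consecutivePrimes_le a i
  simp only [Finset.prod_const, Finset.card_range, Finset.prod_mul_distrib] at this
  exact_mod_cast this

theorem log_fieldSize (p m : ℕ) (t : ℕ → ℕ) :
    Real.log (fieldSize p m t) = (∏ i ∈ Finset.range m, (t i : ℝ)) * Real.log p := by
  simp [fieldSize]

theorem log_codeLength {p m : ℕ} {t : ℕ → ℕ} (hp : p ≠ 0) (hm : m ≠ 0) (ht : 2 ≤ t 0) :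
    Real.log (codeLength p m t) = Real.log m + (t 0 - 2 : ℝ) * Real.log p := by
  have hp' : (p : ℝ) ^ (t 0 - 2) ≠ 0 := by positivity
  rw [codeLength, Nat.cast_mul, Nat.cast_pow, Real.log_mul (by exact_mod_cast hm) hp',
    Real.log_pow, Nat.cast_sub ht]
  simp

open Filter Asymptotics in
/-- Neither the number of blocks nor the two missing dimensions matter for `log n`. -/
theorem log_codeLength_isEquivalent {m : ℕ} (hm : m ≠ 0) {P : ℕ → ℕ} (hP : ∀ a, (P a).Prime) :
    (fun a => Real.log (codeLength (P a) m (consecutivePrimes a))) ~[atTop]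
      fun a => (consecutivePrimes a 0 : ℝ) * Real.log (P a) := by
  have hlog : ∀ a, Real.log 2 ≤ Real.log (P a) := fun a =>
    Real.log_le_log (by norm_num) (by exact_mod_cast (hP a).two_le)
  have hlog2 : 0 < Real.log 2 := Real.log_pos (by norm_num)
  have hbdd : (fun a => Real.log m - 2 * Real.log (P a)) =O[atTop] fun a => Real.log (P a) := by
    refine IsBigO.sub ?_ (isBigO_const_mul_self _ _ _)
    refine IsBigO.of_bound (|Real.log m| / Real.log 2) (Eventually.of_forall fun a => ?_)
    rw [Real.norm_eq_abs, Real.norm_eq_abs, abs_of_pos (hlog2.trans_le (hlog a)), div_mul_eq_mul_div,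
      le_div_iff₀ hlog2]
    exact mul_le_mul_of_nonneg_left (hlog a) (abs_nonneg _)
  have hone : (fun _ : ℕ => (1 : ℝ)) =o[atTop] fun a => (consecutivePrimes a 0 : ℝ) :=
    (isLittleO_const_left.2 (Or.inr (tendsto_norm_atTop_atTop.comp tendsto_consecutivePrimes)))
  have hsmall := hone.mul_isBigO hbdd
  refine hsmall.congr_left fun a => ?_
  rw [Pi.sub_apply, log_codeLength (hP a).ne_zero hm (prime_consecutivePrimes a 0).two_le]
  ring

open Filter Asymptotics in
theorem log_codeLength_isTheta {p m : ℕ} (hp : p.Prime) (hm : m ≠ 0) :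
    (fun a => Real.log (codeLength p m (consecutivePrimes a))) =Θ[atTop]
      fun a => Real.log (fieldSize p m (consecutivePrimes a)) ^ (m : ℝ)⁻¹ := by
  have hlogp : Real.log p ≠ 0 := (Real.log_pos (by exact_mod_cast hp.one_lt)).ne'
  have hlogp' : 0 ≤ Real.log p := Real.log_nonneg (by exact_mod_cast hp.one_le)
  have hprod : (fun a => ∏ i ∈ Finset.range m, (consecutivePrimes a i : ℝ)) =Θ[atTop]
      fun a => (consecutivePrimes a 0 : ℝ) ^ m := by
    refine ⟨IsBigO.of_bound (∏ i ∈ Finset.range m, (2 : ℝ) ^ i) (Eventually.of_forall fun a => ?_),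
      IsBigO.of_bound 1 (Eventually.of_forall fun a => ?_)⟩
    · rw [Real.norm_of_nonneg (by positivity), Real.norm_of_nonneg (by positivity)]
      exact prod_consecutivePrimes_le a m
    · rw [Real.norm_of_nonneg (by positivity), Real.norm_of_nonneg (by positivity), one_mul]
      exact pow_le_prod_consecutivePrimes a m
  have hfield : (fun a => Real.log (fieldSize p m (consecutivePrimes a))) =Θ[atTop]
      fun a => (consecutivePrimes a 0 : ℝ) ^ m := by
    simp only [log_fieldSize]
    simpa only [mul_comm] using (isTheta_const_mul_left hlogp).2 hprod
  have hroot := hfield.rpow (r := (m : ℝ)⁻¹)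
    (Eventually.of_forall fun a => Real.log_natCast_nonneg _)
    (Eventually.of_forall fun a => by positivity)
  have hlength := (log_codeLength_isEquivalent hm (P := fun _ => p) fun _ => hp).isTheta
  refine hlength.trans (IsTheta.trans ?_ hroot.symm)
  have hsimp : ∀ a, ((consecutivePrimes a 0 : ℝ) ^ m) ^ (m : ℝ)⁻¹ = consecutivePrimes a 0 :=
    fun a => Real.pow_rpow_inv_natCast (by positivity) hm
  simp only [hsimp]
  simpa only [mul_comm] using (isTheta_const_mul_left hlogp).2 (isTheta_refl _ _)

open Filter Asymptotics in
/-- Bertrand's postulate lets the logarithm of a prime follow any sequence which tends to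
infinity. -/
theorem exists_primes_log_isEquivalent {L : ℕ → ℝ} (hL : Tendsto L atTop atTop) :
    ∃ P : ℕ → ℕ, (∀ a, (P a).Prime) ∧ (fun a => Real.log (P a)) ~[atTop] L := by
  have hceil : ∀ a, ⌈Real.exp (L a)⌉₊ ≠ 0 := fun a => (Nat.ceil_pos.2 (Real.exp_pos _)).ne'
  choose P hP hlt hle using fun a => Nat.exists_prime_lt_and_le_two_mul _ (hceil a)
  refine ⟨P, hP, ?_⟩
  have hbdd : (fun a => Real.log (P a) - L a) =O[atTop] fun _ => (1 : ℝ) := by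
    refine IsBigO.of_bound (Real.log 4) ?_
    filter_upwards [hL.eventually_ge_atTop 0] with a ha
    have hlower : Real.exp (L a) ≤ P a :=
      (Nat.le_ceil _).trans (by exact_mod_cast (hlt a).le)
    have hupper : (P a : ℝ) ≤ 4 * Real.exp (L a) := by
      have h₁ : (P a : ℝ) ≤ 2 * (⌈Real.exp (L a)⌉₊ : ℝ) := by exact_mod_cast hle a
      have h₂ := Nat.ceil_lt_add_one (Real.exp_pos (L a)).le
      have h₃ := Real.one_le_exp ha
      linarith
    have hpos : (0 : ℝ) < P a := by exact_mod_cast (hP a).pos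
    have h₁ := (Real.le_log_iff_exp_le hpos).2 hlower
    have h₂ := Real.log_le_log hpos hupper
    rw [Real.log_mul (by norm_num) (Real.exp_pos _).ne', Real.log_exp] at h₂
    rw [Real.norm_of_nonneg (by linarith), norm_one]
    linarith
  exact hbdd.trans_isLittleO
    (isLittleO_const_left.2 (Or.inr (tendsto_norm_atTop_atTop.comp hL)))

open Filter Asymptotics in
theorem exists_primes_log_codeLength_isEquivalent {m : ℕ} (hm : m ≠ 0) {ε : ℝ}
    (hε : (m : ℝ)⁻¹ < ε) (hε₁ : ε < 1) :
    ∃ P : ℕ → ℕ, (∀ a, (P a).Prime) ∧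
      (fun a => Real.log (codeLength (P a) m (consecutivePrimes a))) ~[atTop]
        fun a => Real.log (fieldSize (P a) m (consecutivePrimes a)) ^ ε := by
  have hmpos : (0 : ℝ) < m := by positivity
  have hεpos : 0 < ε := (inv_pos.2 hmpos).trans hε
  have hexp : 0 < m * ε - 1 := by
    have := (inv_lt_iff_one_lt_mul₀' hmpos).1 hε
    linarith
  set T : ℕ → ℝ := fun a => ∏ i ∈ Finset.range m, (consecutivePrimes a i : ℝ) with hT
  set u : ℕ → ℝ := fun a => (consecutivePrimes a 0 : ℝ) with hu
  have hupos : ∀ a, 0 < u a := fun a => by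
    simpa [hu] using (prime_consecutivePrimes a 0).pos
  have hTpos : ∀ a, 0 < T a := fun a =>
    Finset.prod_pos fun i _ => by exact_mod_cast (prime_consecutivePrimes a i).pos
  -- `L` solves `u * L = (T * L) ^ ε`, the equation which is wanted of `log p`.
  set L : ℕ → ℝ := fun a => (T a ^ ε / u a) ^ (1 - ε)⁻¹ with hLdef
  have hLpos : ∀ a, 0 < L a := fun a => by have := hTpos a; have := hupos a; positivity
  have hsolve : ∀ a, u a * L a = (T a * L a) ^ ε := fun a => by
    have h₁ : L a ^ (1 - ε) = T a ^ ε / u a := by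
      have := hTpos a
      have := hupos a
      exact Real.rpow_inv_rpow (by positivity) (by linarith)
    rw [Real.mul_rpow (hTpos a).le (hLpos a).le]
    rw [Real.rpow_sub (hLpos a), Real.rpow_one, div_eq_div_iff (by have := hLpos a; positivity)
      (hupos a).ne'] at h₁
    linarith
  have hL : Tendsto L atTop atTop := by
    refine (tendsto_rpow_atTop (inv_pos.2 (by linarith))).comp ?_
    refine tendsto_atTop_mono (fun a => ?_)
      ((tendsto_rpow_atTop hexp).comp tendsto_consecutivePrimes)
    rw [Function.comp_apply, le_div_iff₀ (hupos a)]
    calc u a ^ (m * ε - 1) * u a = (u a ^ m) ^ ε := by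
          rw [← Real.rpow_natCast, ← Real.rpow_mul (hupos a).le, ← Real.rpow_add_one (hupos a).ne']
          congr 1
          ring
      _ ≤ T a ^ ε := Real.rpow_le_rpow (by have := hupos a; positivity)
          (pow_le_prod_consecutivePrimes a m) hεpos.le
  obtain ⟨P, hP, hPL⟩ := exists_primes_log_isEquivalent hL
  refine ⟨P, hP, (log_codeLength_isEquivalent hm hP).trans ?_⟩
  have hleft : (fun a => u a * Real.log (P a)) ~[atTop] fun a => u a * L a :=
    IsEquivalent.refl.mul hPL
  have hright : (fun a => T a * Real.log (P a)) ~[atTop] fun a => T a * L a :=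
    IsEquivalent.refl.mul hPL
  have hpow := hright.rpow (r := ε) (fun a => by
    have := hTpos a; have := hLpos a; simp only [Pi.zero_apply]; positivity)
  simp only [log_fieldSize]
  refine hleft.trans ?_
  simp only [hsolve]
  exact hpow.symm

/-! ### The codes -/

section ReedSolomon

variable {F : Type*} [Field F] {n : ℕ}

theorem mem_reedSolomon_two {α : Fin n → F} {c : Fin n → F} :
    c ∈ reedSolomon 2 α ↔ ∃ a b : F, c = fun i => a * α i + b := by
  simp only [reedSolomon, Submodule.mem_map]
  constructor
  · rintro ⟨f, hf, rfl⟩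
    have hdeg : f.degree ≤ 1 := Order.le_of_lt_succ (Polynomial.mem_degreeLT.1 hf)
    refine ⟨f.coeff 1, f.coeff 0, funext fun i => ?_⟩
    simp only [LinearMap.pi_apply, Polynomial.leval_apply]
    conv_lhs => rw [Polynomial.eq_X_add_C_of_degree_le_one hdeg]
    simp
  · rintro ⟨a, b, rfl⟩
    refine ⟨Polynomial.C a * Polynomial.X + Polynomial.C b, Polynomial.mem_degreeLT.2 ?_, ?_⟩
    · exact lt_of_le_of_lt Polynomial.degree_linear_le (by norm_num)
    · ext i
      simp [LinearMap.pi_apply, Polynomial.leval_apply]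

theorem finrank_reedSolomon_two {α : Fin n → F} (hα : Function.Injective α) (hn : 2 ≤ n) :
    Module.finrank F (reedSolomon 2 α) = 2 := by
  rw [reedSolomon, ← LinearMap.range_domRestrict, LinearMap.finrank_range_of_inj]
  · rw [(Polynomial.degreeLTEquiv F 2).finrank_eq, Module.finrank_fin_fun]
  · rw [← LinearMap.ker_eq_bot, LinearMap.ker_eq_bot']
    rintro ⟨f, hf⟩ hzero
    refine Subtype.ext (Polynomial.eq_zero_of_degree_lt_of_eval_index_eq_zero
      (s := Finset.univ) (v := α) hα.injOn ?_ fun i _ => congrFun hzero i)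
    refine (Polynomial.mem_degreeLT.1 hf).trans_le ?_
    rw [Finset.card_univ, Fintype.card_fin]
    exact_mod_cast hn

/-- Two different codewords share at most as many letters as some nontrivial affine map keeps
evaluation points: the letters of `a * x + b` and `a' * x + b'` agree where the second point is the
image of the first under `x ↦ (a * x + b - b') / a'`. -/
theorem two_mul_le_minInsdelDist {α : Fin n → F} (hα : Function.Injective α) (hn : 2 ≤ n) {L : ℕ}
    (hL : 1 ≤ L)
    (h : ∀ A B : F, A ≠ 0 → ¬(A = 1 ∧ B = 0) →
      {x | x ∈ Set.range α ∧ A * x + B ∈ Set.range α}.ncard ≤ L) :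
    2 * n ≤ minInsdelDist (reedSolomon 2 α : Set (Fin n → F)) + 2 * L := by
  have hne : {d : ℕ | ∃ c₁ ∈ (reedSolomon 2 α : Set (Fin n → F)),
      ∃ c₂ ∈ (reedSolomon 2 α : Set (Fin n → F)), c₁ ≠ c₂ ∧
        d = insdelDist (List.ofFn c₁) (List.ofFn c₂)}.Nonempty := by
    refine ⟨_, fun _ => 0, mem_reedSolomon_two.2 ⟨0, 0, by simp⟩, fun _ => 1,
      mem_reedSolomon_two.2 ⟨0, 1, by simp⟩, fun h => ?_, rfl⟩
    exact zero_ne_one (congrFun h ⟨0, by omega⟩)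
  obtain ⟨c₁, hc₁, c₂, hc₂, hc, hd⟩ := Nat.sInf_mem hne
  obtain ⟨a, b, rfl⟩ := mem_reedSolomon_two.1 hc₁
  obtain ⟨a', b', rfl⟩ := mem_reedSolomon_two.1 hc₂
  rw [minInsdelDist, hd]
  have hinj : ∀ a b : F, a ≠ 0 → Function.Injective fun i => a * α i + b := fun a b ha i j hij =>
    hα (mul_left_cancel₀ ha (add_right_cancel hij))
  have hconst : ∀ (b : F) (s : Set F),
      (Set.range (fun i => 0 * α i + b) ∩ s).ncard ≤ L := fun b s => by
    refine le_trans ?_ hL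
    rw [← Set.ncard_singleton b]
    refine Set.ncard_le_ncard ?_
    rintro _ ⟨⟨i, rfl⟩, -⟩
    simp
  have hmain : (Function.Injective (fun i => a * α i + b) ∨
      Function.Injective (fun i => a' * α i + b') ∨
      Disjoint (Set.range fun i => a * α i + b) (Set.range fun i => a' * α i + b')) ∧
      (Set.range (fun i => a * α i + b) ∩ Set.range fun i => a' * α i + b').ncard ≤ L := by
    rcases eq_or_ne a 0 with rfl | ha
    · refine ⟨?_, hconst b _⟩
      rcases eq_or_ne a' 0 with rfl | ha'
      · refine Or.inr (Or.inr (Set.disjoint_left.2 ?_))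
        rintro _ ⟨i, rfl⟩ ⟨j, hj⟩
        simp only [zero_mul, zero_add] at hj
        exact hc (by rw [hj])
      · exact Or.inr (Or.inl (hinj a' b' ha'))
    · refine ⟨Or.inl (hinj a b ha), ?_⟩
      rcases eq_or_ne a' 0 with rfl | ha'
      · rw [Set.inter_comm]
        exact hconst b' _
      · have hAB : ¬(a / a' = 1 ∧ (b - b') / a' = 0) := by
          rintro ⟨h₁, h₂⟩
          have h₁ : a = a' := (div_eq_one_iff_eq ha').1 h₁
          have h₂ : b = b' := sub_eq_zero.1 ((div_eq_zero_iff.1 h₂).resolve_right ha')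
          exact hc (by rw [h₁, h₂])
        have hfin : {x | x ∈ Set.range α ∧ a / a' * x + (b - b') / a' ∈ Set.range α}.Finite :=
          (Set.finite_range α).subset fun x hx => hx.1
        refine le_trans ?_ (h (a / a') ((b - b') / a') (div_ne_zero ha ha') hAB)
        refine le_trans (Set.ncard_le_ncard ?_ (hfin.image fun x => a * x + b))
          (Set.ncard_image_le hfin)
        rintro _ ⟨⟨i, rfl⟩, ⟨j, hj⟩⟩
        refine ⟨α i, ⟨⟨i, rfl⟩, j, ?_⟩, rfl⟩
        simp only at hj
        field_simp
        linear_combination hj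
  have := two_mul_le_insdelDist_ofFn hmain.1
  have := hmain.2
  omega

end ReedSolomon

section Blocks

variable {p : ℕ} [Fact p.Prime] {F : Type*} [Field F] [Algebra (ZMod p) F] {t : ℕ → ℕ} {m : ℕ}

theorem GeneratesSubfields.isBlockFamily [Finite F] {β : Fin m → F}
    (hβ : GeneratesSubfields p t β) (hprime : ∀ i, (t i).Prime) (ht : StrictMono t) :
    IsBlockFamily p (fun i : Fin m => t i) β fun i => powerSpan p (t 0) (β i) where
  prime i := hprime i
  injective := ht.injective.comp Fin.val_injective
  base_mem i := mem_frobeniusFixed_of_card_adjoin (hβ i)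
  direction_mem i := powerSpan_le (mem_frobeniusFixed_of_card_adjoin (hβ i))
  eq_zero i _ _ := eq_zero_of_smul_add_mem_frobeniusFixed_one (hprime 0).two_le
    ((ht.monotone (Nat.zero_le i)).trans_eq (natDegree_minpoly_of_card_adjoin (hβ i)).symm)

theorem GeneratesSubfields.natCard_powerSpan [Finite F] {β : Fin m → F}
    (hβ : GeneratesSubfields p t β) (ht : StrictMono t) (i : Fin m) :
    Nat.card (powerSpan p (t 0) (β i)) = p ^ (t 0 - 2) :=
  _root_.natCard_powerSpan
    ((ht.monotone (Nat.zero_le i)).trans_eq (natDegree_minpoly_of_card_adjoin (hβ i)).symm)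

theorem evalSet_eq_iUnion (r : ℕ) (β : Fin m → F) :
    evalSet p r β = ⋃ i, {x | x - β i ∈ powerSpan p r (β i)} := by
  ext x
  simp [evalSet, mem_affineBlock]

theorem exists_generatesSubfields [Finite F] (hprime : ∀ i, (t i).Prime)
    (hF : Nat.card F = fieldSize p m t) : ∃ β : Fin m → F, GeneratesSubfields p t β := by
  choose β hβ using fun i : Fin m => exists_card_adjoin_eq (hprime i).ne_zero
    (Finset.dvd_prod_of_mem t (Finset.mem_range.2 i.2)) hF
  exact ⟨β, hβ⟩

theorem ncard_evalSet [Finite F] {β : Fin m → F} (hβ : GeneratesSubfields p t β)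
    (hprime : ∀ i, (t i).Prime) (ht : StrictMono t) :
    (evalSet p (t 0) β).ncard = codeLength p m t := by
  rw [evalSet_eq_iUnion,
    (hβ.isBlockFamily hprime ht).ncard_iUnion_blocks (hβ.natCard_powerSpan ht), Fintype.card_fin]
  rfl

theorem two_le_codeLength (hm : m ≠ 0) (h5 : 5 ≤ t 0) : 2 ≤ codeLength p m t := by
  have hp := (Fact.out : p.Prime).two_le
  calc 2 ≤ p := hp
    _ ≤ p ^ (t 0 - 2) := Nat.le_self_pow (by omega) p
    _ ≤ m * p ^ (t 0 - 2) := Nat.le_mul_of_pos_left _ (Nat.pos_of_ne_zero hm)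

theorem two_mul_codeLength_le [Finite F] {β : Fin m → F} (hβ : GeneratesSubfields p t β)
    (hm : m ≠ 0) (hprime : ∀ i, (t i).Prime) (ht : StrictMono t) (h5 : 5 ≤ t 0)
    {α : Fin (codeLength p m t) → F} (hα : Function.Injective α)
    (hrange : Set.range α = evalSet p (t 0) β) :
    2 * codeLength p m t ≤
      minInsdelDist (reedSolomon 2 α : Set (Fin (codeLength p m t) → F)) +
        2 * (p ^ (t 0 - 2) + m ^ 2) := by
  have hp := (Fact.out : p.Prime).two_le
  -- Here `t 0 ≥ 5` makes two lines over the prime field no larger than one block.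
  have hblock : 2 * p ≤ p ^ (t 0 - 2) :=
    calc 2 * p ≤ p ^ 2 := by rw [sq]; gcongr
      _ ≤ p ^ (t 0 - 2) := Nat.pow_le_pow_right (by omega) (by omega)
  refine two_mul_le_minInsdelDist hα (two_le_codeLength hm h5) ?_ fun A B hA hAB => ?_
  · exact (Nat.one_le_pow _ _ (by omega)).trans (Nat.le_add_right _ _)
  · have := (hβ.isBlockFamily hprime ht).ncard_affine_le (hβ.natCard_powerSpan ht) hblock hA hAB
    rw [Fintype.card_fin] at this
    simpa only [hrange, evalSet_eq_iUnion, Set.mem_iUnion] using! this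

end Blocks

/-- The loss `2 * m ^ 2` of a union of `m` blocks is `O(1 / ε ^ 2)` since `m ≤ 2 / ε`, and a block
is the `m`-th part of the evaluation set, where `1 / m ≤ ε`. -/
theorem distance_bound {ε m N d : ℝ} (hε : 0 < ε) (hm : 0 < m) (hN : 0 ≤ N) (h₁ : m⁻¹ ≤ ε)
    (h₂ : ε ≤ 2 * m⁻¹) (hd : 2 * (m * N) ≤ d + 2 * (N + m ^ 2)) :
    2 * (1 - ε) * (m * N) - 8 / ε ^ 2 ≤ d := by
  have hmε : 1 ≤ ε * m := by
    have := mul_le_mul_of_nonneg_right h₁ hm.le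
    rwa [inv_mul_cancel₀ hm.ne'] at this
  have hεm : m * ε ≤ 2 := by
    have := mul_le_mul_of_nonneg_left h₂ hm.le
    rwa [mul_left_comm, mul_inv_cancel₀ hm.ne', mul_one] at this
  have hsq : 2 * m ^ 2 ≤ 8 / ε ^ 2 := by
    rw [le_div_iff₀ (by positivity)]
    calc 2 * m ^ 2 * ε ^ 2 = 2 * (m * ε) ^ 2 := by ring
      _ ≤ 2 * 2 ^ 2 := by gcongr
      _ = 8 := by norm_num
  have hN' : N ≤ ε * m * N := le_mul_of_one_le_left hN hmε
  linarith

/-- The absolute constant `K` is the constant of `O(1 / ε ^ 2)`. -/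
theorem theorem2 :
    ∃ K : ℝ, 0 < K ∧ ∀ ε : ℝ, 0 < ε → ε < 1 →
      ∀ s : ℕ, 1 ≤ s → ((2 : ℝ) ^ s)⁻¹ ≤ ε → ε ≤ 2 * ((2 : ℝ) ^ s)⁻¹ →
      -- the codes: dimension, length and distance
      (∀ (p : ℕ) [Fact p.Prime] (t : ℕ → ℕ), (∀ i, (t i).Prime) → StrictMono t → 5 ≤ t 0 →
        ∀ (F : Type*) [Field F] [Algebra (ZMod p) F],
          Nat.card F = fieldSize p (2 ^ s) t →
          (∃ β : Fin (2 ^ s) → F, GeneratesSubfields p t β) ∧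
          ∀ β : Fin (2 ^ s) → F, GeneratesSubfields p t β →
            (evalSet p (t 0) β).ncard = codeLength p (2 ^ s) t ∧
            ∀ α : Fin (codeLength p (2 ^ s) t) → F,
              Function.Injective α → Set.range α = evalSet p (t 0) β →
              Module.finrank F (reedSolomon 2 α) = 2 ∧
              2 * (1 - ε) * (codeLength p (2 ^ s) t : ℝ) - K / ε ^ 2
                ≤ (minInsdelDist (reedSolomon 2 α : Set (Fin (codeLength p (2 ^ s) t) → F)) : ℝ)) ∧
      -- the length for a fixed characteristic: `n = exp (Θ ((log q) ^ (1 / 2 ^ s)))`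
      (∀ p : ℕ, p.Prime →
        (fun a : ℕ => Real.log (codeLength p (2 ^ s) (consecutivePrimes a)))
          =Θ[Filter.atTop]
        (fun a : ℕ => Real.log (fieldSize p (2 ^ s) (consecutivePrimes a)) ^ ((2 : ℝ) ^ s)⁻¹)) ∧
      -- the length `n = exp ((1 + o(1)) (log q) ^ ε)` for a suitable choice of characteristics
      (((2 : ℝ) ^ s)⁻¹ < ε →
        ∃ P : ℕ → ℕ, (∀ a, (P a).Prime) ∧
          Asymptotics.IsEquivalent Filter.atTop
            (fun a : ℕ => Real.log (codeLength (P a) (2 ^ s) (consecutivePrimes a)))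
            (fun a : ℕ => Real.log (fieldSize (P a) (2 ^ s) (consecutivePrimes a)) ^ ε)) := by
  refine ⟨8, by norm_num, fun ε hε hε₁ s _ hlow hhigh => ⟨?_, ?_, ?_⟩⟩
  · intro p _ t hprime ht h5 F _ _ hF
    have hm : 2 ^ s ≠ 0 := by positivity
    have : Finite F := (Nat.card_pos_iff.1 (by
      rw [hF]
      exact pow_pos (Fact.out : p.Prime).pos _)).2
    refine ⟨exists_generatesSubfields hprime hF, fun β hβ =>
      ⟨ncard_evalSet hβ hprime ht, fun α hα hrange =>
        ⟨finrank_reedSolomon_two hα (two_le_codeLength hm h5), ?_⟩⟩⟩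
    have hd := two_mul_codeLength_le hβ hm hprime ht h5 hα hrange
    have hlength : (codeLength p (2 ^ s) t : ℝ) = 2 ^ s * (p : ℝ) ^ (t 0 - 2) := by
      simp [codeLength]
    rw [hlength]
    refine distance_bound hε (by positivity) (by positivity) hlow hhigh ?_
    rw [← hlength]
    exact_mod_cast hd
  · intro p hp
    simpa using log_codeLength_isTheta (m := 2 ^ s) hp (by positivity)
  · intro hlt
    exact exists_primes_log_codeLength_isEquivalent (m := 2 ^ s) (by positivity)
      (by simpa using hlt) hε₁
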